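/- Let $d\ge 2$. There are real numbers $\alpha'_1,\dots,\alpha'_{d-2}$, depending only on $d$, such that the following holds for every finite $(d-1)$-dimensional simplicial complex $\Delta$, on a ground set $\{1,\dots,n\}$ for some $n$. For $r\ge1$ let $\Delta^{\langle r\rangle}$ be the $r$-th edgewise subdivision of $\Delta$, that is, the simplicial complex on the ground set $\Omega_r=\{v\in\mathbb N^n: v_1+\dots+v_n=r\}$ in which $A\subseteq\Omega_r$ is a face if and only if $\bigcup_{v\in A}\operatorname{supp}(v)\in\Delta$ and, for all $v,w\in A$, $\iota(v-w)\in\{0,1\}^n$ or $\iota(w-v)\in\{0,1\}^n$, where $\iota(a)=(a_1,\,a_1+a_2,\,\dots,\,a_1+\dots+a_n)$. More generally, $\Delta^{\langle r\rangle}$ may be any finite simplicial complex such that, for some field $k$, the Stanley–Reisner ring $k[\Delta^{\langle r\rangle}]$ has the same Hilbert series as the $r$-th Veronese algebra $\bigoplus_{m\ge0}k[\Delta]_{mr}$ of the Stanley–Reisner ring of $\Delta$. Write $f^{\langle r\rangle}_{i}$ for the number of $i$-dimensional faces of $\Delta^{\langle r\rangle}$ (so $f^{\langle r\rangle}_{-1}=1$).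 Then there are an integer $R>0$ and sequences of complex numbers $(\beta^{(i)}_r)_{r\ge1}$, $1\le i\le d$, depending only on $\Delta$ (not on the choice of the complexes $\Delta^{\langle r\rangle}$), such that 1. for $r>R$, $\beta^{(i)}_r$ is real for $1\le i\le d$ and strictly negative for $1\le i\le d-1$; 2. $\beta^{(i)}_r\to\alpha'_i$ as $r\to\infty$, for $1\le i\le d-2$; 3. $\beta^{(d-1)}_r\to-\infty$ as $r\to\infty$; 4. $\beta^{(d)}_r\to-1$ as $r\to\infty$; 5. for $r>R$, the $f$-polynomial satisfies $f^{\langle r\rangle}_{-1}+f^{\langle r\rangle}_0t+\dots+f^{\langle r\rangle}_{d-1}t^d=\prod_{i=1}^d\bigl(1-\beta^{(i)}_r t\bigr)$, and $\Delta^{\langle r\rangle}$ has no faces of dimension $\ge d$. Moreover, for $r>R$ the $f$-vector $(f^{\langle r\rangle}_{-1},\dots,f^{\langle r\rangle}_{d-1})$ is log-concave and unimodal. -/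

import Mathlib

open Finset Filter Topology Polynomial

/-! ### Simplicial complexes

A (finite) simplicial complex on the ground set `W` is a `PreAbstractSimplicialComplex W`; not every
element of `W` has to be a vertex.  Mathlib's structure lists the nonempty faces only; the empty set
is always a face (of dimension `-1`). -/

namespace PreAbstractSimplicialComplex

/-- `s` is a face of `K`, the empty face being included. -/
def IsFace {W : Type*} (K : PreAbstractSimplicialComplex W) (s : Finset W) : Prop :=
  s = ∅ ∨ s ∈ K

/-- `K` has dimension `m`: there is a face with `m + 1` vertices, and no face has more. -/
def HasDim {W : Type*} (K : PreAbstractSimplicialComplex W) (m : ℕ) : Prop :=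
  (∃ s, K.IsFace s ∧ s.card = m + 1) ∧ ∀ s, K.IsFace s → s.card ≤ m + 1

/-- `K.fVec i` is the number of faces with `i` vertices, that is, the entry `f_{i-1}` of the
`f`-vector. -/
noncomputable def fVec {W : Type*} [Finite W] (K : PreAbstractSimplicialComplex W) (i : ℕ) : ℕ :=
  {s : Finset W | K.IsFace s ∧ s.card = i}.ncard

/-- The `f`-polynomial `f_{-1} + f_0 t + f_1 t ^ 2 + ⋯`, over the complex numbers. No face has more
than `Nat.card W` vertices, so the sum comprises the whole `f`-vector. -/
noncomputable def fPoly {W : Type*} [Finite W] (K : PreAbstractSimplicialComplex W) : ℂ[X] :=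
  ∑ i ∈ range (Nat.card W + 1), C (K.fVec i : ℂ) * X ^ i

end PreAbstractSimplicialComplex

/-- The finite sequence `a 0, …, a d` is log-concave. -/
def IsLogConcave (d : ℕ) (a : ℕ → ℕ) : Prop :=
  ∀ i, 1 ≤ i → i + 1 ≤ d → a (i - 1) * a (i + 1) ≤ a i ^ 2

/-- The finite sequence `a 0, …, a d` is unimodal. -/
def IsUnimodal (d : ℕ) (a : ℕ → ℕ) : Prop :=
  ∃ m ≤ d, (∀ i j, i ≤ j → j ≤ m → a i ≤ a j) ∧ (∀ i j, m ≤ i → i ≤ j → j ≤ d → a j ≤ a i)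

/-! ### Edgewise subdivision -/

/-- The set `Ω_r` of the vectors in `ℕ ^ n` with coordinate sum `r`. -/
abbrev EdgewiseVertex (n r : ℕ) : Type := {a : Fin n → ℕ // ∑ i, a i = r}

instance EdgewiseVertex.finite (n r : ℕ) : Finite (EdgewiseVertex n r) := by
  refine Finite.of_injective
    (fun (a : EdgewiseVertex n r) (i : Fin n) => (⟨a.1 i, ?_⟩ : Fin (r + 1))) ?_
  · have h := Finset.single_le_sum (f := a.1) (fun _ _ => Nat.zero_le _) (Finset.mem_univ i)
    have h2 := a.2
    omega
  · intro a b h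
    apply Subtype.ext
    funext i
    exact congrArg Fin.val (congrFun h i)

/-- The support of a vector. -/
def EdgewiseVertex.supp {n r : ℕ} (a : EdgewiseVertex n r) : Finset (Fin n) :=
  {i | a.1 i ≠ 0}

/-- The difference of two vectors. -/
def EdgewiseVertex.diff {n r : ℕ} (v w : EdgewiseVertex n r) : Fin n → ℤ :=
  fun i => (v.1 i : ℤ) - (w.1 i : ℤ)

/-- The vector `u_i = e_i + e_{i+1} + ⋯ + e_n`. -/
def edgewiseU {n : ℕ} (i : Fin n) : Fin n → ℤ := ∑ j ∈ Finset.Ici i, Pi.single j 1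

/-- The map `ι(a) = a_1 u_1 + ⋯ + a_n u_n`. -/
def edgewiseIota {n : ℕ} (a : Fin n → ℤ) : Fin n → ℤ := ∑ i, a i • edgewiseU i

/-- The `r`-th edgewise subdivision of a simplicial complex on `{1, …, n}`. -/
def edgewiseSubdivision {n : ℕ} (Δ : PreAbstractSimplicialComplex (Fin n)) (r : ℕ) :
    PreAbstractSimplicialComplex (EdgewiseVertex n r) where
  faces := {A | A.Nonempty ∧ Δ.IsFace (A.biUnion EdgewiseVertex.supp) ∧
    ∀ v ∈ A, ∀ w ∈ A,
      (∀ j, edgewiseIota (v.diff w) j = 0 ∨ edgewiseIota (v.diff w) j = 1) ∨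
      (∀ j, edgewiseIota (w.diff v) j = 0 ∨ edgewiseIota (w.diff v) j = 1)}
  isRelLowerSet_faces := by
    rintro A ⟨hA, hf, h2⟩
    refine ⟨hA, fun B hBA hB => ⟨hB, ?_, fun v hv w hw => h2 v (hBA hv) w (hBA hw)⟩⟩
    have hsub : B.biUnion EdgewiseVertex.supp ⊆ A.biUnion EdgewiseVertex.supp :=
      Finset.biUnion_subset_biUnion_of_subset_left _ hBA
    rcases Finset.eq_empty_or_nonempty (B.biUnion EdgewiseVertex.supp) with h0 | h0
    · exact Or.inl h0
    · rcases hf with hf | hf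
      · rw [hf] at hsub
        exact Or.inl (Finset.subset_empty.mp hsub)
      · exact Or.inr ((Δ.isRelLowerSet_faces hf).2 hsub h0)

/-! ### Stanley-Reisner rings and Hilbert series -/

/-- The Stanley-Reisner ideal: it is generated by the squarefree monomials of the non-faces. -/
noncomputable def stanleyReisnerIdeal (k : Type*) [Field k] {W : Type*}
    (K : PreAbstractSimplicialComplex W) : Ideal (MvPolynomial W k) :=
  Ideal.span {p | ∃ A : Finset W, ¬ K.IsFace A ∧ p = ∏ w ∈ A, MvPolynomial.X w}

/-- The Stanley-Reisner ring `k[K]`. -/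
abbrev StanleyReisnerRing (k : Type*) [Field k] {W : Type*}
    (K : PreAbstractSimplicialComplex W) : Type _ :=
  MvPolynomial W k ⧸ stanleyReisnerIdeal k K

/-- The graded pieces of the Stanley-Reisner ring: the images of the spaces of homogeneous
polynomials. -/
noncomputable def stanleyReisnerGrading (k : Type*) [Field k] {W : Type*}
    (K : PreAbstractSimplicialComplex W) (m : ℕ) : Submodule k (StanleyReisnerRing k K) :=
  (MvPolynomial.homogeneousSubmodule W k m).map
    (Ideal.Quotient.mkₐ k (stanleyReisnerIdeal k K)).toLinearMap

/-- The graded pieces of the `r`-th Veronese algebra `⨁ m, A_{m r}` of an algebra `A` with graded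
pieces `𝒜 m`. -/
def veroneseGrading {k A : Type*} [Field k] [CommRing A] [Algebra k A] (𝒜 : ℕ → Submodule k A)
    (r : ℕ) : ℕ → Submodule k A :=
  fun m => 𝒜 (m * r)

/-- The Hilbert series `∑ (dim 𝒜 m) t ^ m`. -/
noncomputable def hilbertSeries {k A : Type*} [Field k] [CommRing A] [Algebra k A]
    (𝒜 : ℕ → Submodule k A) : PowerSeries ℕ :=
  PowerSeries.mk fun m => Module.finrank k (𝒜 m)

/-! The Stanley–Reisner ideal is monomial, so the degree-`m` piece of `k[Δ]` has a basis of
monomials supported on faces. Counting them by support gives, for `m ≥ 1`, the value at `m` of a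
polynomial `p` of degree `d - 1` with positive leading coefficient. A complex with the Hilbert
series of the `r`-th Veronese algebra has Hilbert function `p (r * m)` for `m ≥ 1`. The edgewise
subdivision is such a complex: a multiset of `m` pairwise compatible vertices is determined by its
sum, and every vector of total `m * r` is such a sum (`ncard_faceMonomials_edgewiseSubdivision`).

The Hilbert function determines the `f`-vector through a triangular binomial transform. If `E_l` is
the polynomial that this transform sends to the power `m ^ l`, the `f`-polynomial is therefore `1 +
∑ p_l r ^ l E_l`; it depends only on `Δ` and `r`. Divided by `r ^ (d - 1)`, it converges to a
nonzero multiple of `E_{d-1}`, which depends only on `d`.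

As `E_{l+1} = X (1 + X) E_l'`, Rolle's theorem gives `E_{d-1}` exactly `d` simple roots in `[-1,
0]`, both endpoints included. Simple roots persist, so for large `r` the `f`-polynomial has `d`
distinct real roots near them, all negative because its coefficients count faces. The `β` are the
reciprocals of these roots: the root near `0` gives the one tending to `-∞`, the root near `-1` the
one tending to `-1`. Log-concavity and unimodality follow from the factorization into factors `1 + b
X` with `b ≥ 0`. -/

namespace PreAbstractSimplicialComplex

/-! ### Faces and the `f`-vector -/

variable {W : Type*}

theorem IsFace.mono {K : PreAbstractSimplicialComplex W} {s t : Finset W} (hs : K.IsFace s)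
    (hts : t ⊆ s) : K.IsFace t := by
  rcases t.eq_empty_or_nonempty with ht | ht
  · exact Or.inl ht
  · rcases hs with rfl | hs
    · exact Or.inl (Finset.subset_empty.mp hts)
    · exact Or.inr ((K.isRelLowerSet_faces hs).2 hts ht)

/-- The exponents of the monomials of degree `m` that are supported on a face. -/
def faceMonomials (K : PreAbstractSimplicialComplex W) (m : ℕ) : Set (W →₀ ℕ) :=
  {s | K.IsFace s.support ∧ s.degree = m}

theorem fVec_zero [Finite W] (K : PreAbstractSimplicialComplex W) : K.fVec 0 = 1 := by
  rw [fVec, Set.ncard_eq_one]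
  refine ⟨∅, ?_⟩
  ext s
  simp only [Set.mem_ofPred_eq, Finset.card_eq_zero, Set.mem_singleton_iff]
  exact ⟨fun h => h.2, fun h => ⟨Or.inl h, h⟩⟩

theorem fVec_eq_zero_of_card_lt [Finite W] (K : PreAbstractSimplicialComplex W) {i : ℕ}
    (hi : ∀ s, K.IsFace s → s.card < i) : K.fVec i = 0 := by
  rw [fVec, Set.ncard_eq_zero (Set.toFinite _), Set.eq_empty_iff_forall_notMem]
  rintro s ⟨hs, rfl⟩
  exact lt_irrefl _ (hi s hs)

theorem coeff_fPoly [Finite W] (K : PreAbstractSimplicialComplex W) (i : ℕ) :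
    K.fPoly.coeff i = K.fVec i := by
  simp only [fPoly, finsetSum_coeff, coeff_C_mul, coeff_X_pow, mul_ite, mul_one, mul_zero,
    Finset.sum_ite_eq, Finset.mem_range]
  split_ifs with h
  · rfl
  · rw [K.fVec_eq_zero_of_card_lt, Nat.cast_zero]
    intro s _
    have := Fintype.ofFinite W
    have h2 := Finset.card_le_univ s
    rw [← Nat.card_eq_fintype_card] at h2
    omega

end PreAbstractSimplicialComplex

open PreAbstractSimplicialComplex

/-! ### The Hilbert function of the Stanley–Reisner ring -/

/-- A monomial is divisible by the squarefree monomial of a non-face exactly when its support is a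
non-face, because faces are closed under subsets. -/
theorem mem_stanleyReisnerIdeal_iff (k : Type*) [Field k] {W : Type*}
    (K : PreAbstractSimplicialComplex W) (p : MvPolynomial W k) :
    p ∈ stanleyReisnerIdeal k K ↔ ∀ s ∈ p.support, ¬ K.IsFace s.support := by
  classical
  have hset : {p : MvPolynomial W k | ∃ A : Finset W, ¬ K.IsFace A ∧
      p = ∏ w ∈ A, MvPolynomial.X w} = (fun s => MvPolynomial.monomial s (1 : k)) ''
        {s | ∃ A : Finset W, ¬ K.IsFace A ∧ s = ∑ w ∈ A, Finsupp.single w 1} := by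
    ext p
    constructor
    · rintro ⟨A, hA, rfl⟩
      exact ⟨_, ⟨A, hA, rfl⟩, MvPolynomial.monomial_sum_one _ _⟩
    · rintro ⟨_, ⟨A, hA, rfl⟩, rfl⟩
      exact ⟨A, hA, MvPolynomial.monomial_sum_one _ _⟩
  rw [stanleyReisnerIdeal, hset, MvPolynomial.mem_ideal_span_monomial_image]
  have happ : ∀ (A : Finset W) (w : W),
      (∑ v ∈ A, Finsupp.single v (1 : ℕ)) w = if w ∈ A then 1 else 0 := by
    intro A w
    simp [Finsupp.finsetSum_apply, Finsupp.single_apply]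
  refine forall₂_congr fun s _ => ⟨?_, fun h => ⟨_, ⟨s.support, h, rfl⟩, fun w => ?_⟩⟩
  · rintro ⟨_, ⟨A, hA, rfl⟩, hle⟩ hs
    refine hA (hs.mono fun w hw => ?_)
    have := hle w
    rw [happ, if_pos hw] at this
    exact Finsupp.mem_support_iff.mpr (by omega)
  · rw [happ]
    split_ifs with hw
    · exact Nat.one_le_iff_ne_zero.mpr (Finsupp.mem_support_iff.mp hw)
    · exact Nat.zero_le _

theorem stanleyReisnerGrading_eq_map_restrictSupport (k : Type*) [Field k] {W : Type*}
    (K : PreAbstractSimplicialComplex W) (m : ℕ) :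
    stanleyReisnerGrading k K m = (MvPolynomial.restrictSupport k (K.faceMonomials m)).map
      (Ideal.Quotient.mkₐ k (stanleyReisnerIdeal k K)).toLinearMap := by
  classical
  have hhom : MvPolynomial.homogeneousSubmodule W k m =
      MvPolynomial.restrictSupport k {s | s.degree = m} :=
    MvPolynomial.homogeneousSubmodule_eq_finsupp_supported W k m
  rw [stanleyReisnerGrading, hhom]
  refine le_antisymm ?_ (Submodule.map_mono (MvPolynomial.restrictSupport_mono k fun s hs => hs.2))
  rw [MvPolynomial.restrictSupport_eq_span, Submodule.map_span_le]
  rintro _ ⟨s, hs, rfl⟩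
  by_cases hf : K.IsFace s.support
  · exact Submodule.mem_map_of_mem ((MvPolynomial.monomial_mem_restrictSupport k).2
      (Or.inl ⟨hf, hs⟩))
  · have : (Ideal.Quotient.mkₐ k (stanleyReisnerIdeal k K)).toLinearMap
        (MvPolynomial.monomial s 1) = 0 := by
      refine Ideal.Quotient.eq_zero_iff_mem.2 ((mem_stanleyReisnerIdeal_iff k K _).2 ?_)
      intro t ht
      rw [MvPolynomial.support_monomial, if_neg one_ne_zero, Finset.mem_singleton] at ht
      rwa [ht]
    rw [this]
    exact Submodule.zero_mem _

theorem finrank_stanleyReisnerGrading (k : Type*) [Field k] {W : Type*}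
    (K : PreAbstractSimplicialComplex W) (m : ℕ) :
    Module.finrank k (stanleyReisnerGrading k K m) = (K.faceMonomials m).ncard := by
  rw [stanleyReisnerGrading_eq_map_restrictSupport, ← LinearMap.range_domRestrict,
    LinearMap.finrank_range_of_inj,
    Module.finrank_eq_nat_card_basis (MvPolynomial.basisRestrictSupport k (K.faceMonomials m)),
    Nat.card_coe_set_eq]
  rw [← LinearMap.ker_eq_bot, LinearMap.ker_eq_bot']
  rintro ⟨p, hp⟩ h0
  have h1 : p ∈ stanleyReisnerIdeal k K := Ideal.Quotient.eq_zero_iff_mem.1 h0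
  rw [mem_stanleyReisnerIdeal_iff] at h1
  rw [Subtype.ext_iff]
  change p = 0
  rw [← MvPolynomial.support_eq_empty, Finset.eq_empty_iff_forall_notMem]
  exact fun s hs => h1 s hs ((MvPolynomial.mem_restrictSupport_iff k).1 hp hs).1

/-- The number of exponents of degree `m + 1` with a given support. -/
theorem card_finsuppAntidiag_filter_support_eq {W : Type*} [Fintype W] [DecidableEq W]
    (A : Finset W) (m : ℕ) :
    #{s ∈ (Finset.univ : Finset W).finsuppAntidiag (m + 1) | s.support = A} =
      if #A = 0 then 0 else m.choose (#A - 1) := by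
  split_ifs with h0
  · rw [Finset.card_eq_zero] at h0
    subst h0
    rw [Finset.card_eq_zero, Finset.filter_eq_empty_iff]
    intro s hs h
    rw [Finsupp.support_eq_empty] at h
    subst h
    simp at hs
  have hsum : ∀ s : W →₀ ℕ, s.support ⊆ A → ∑ w, s w = ∑ w ∈ A, s w := fun s hs =>
    (Finset.sum_subset (Finset.subset_univ A) fun w _ hw =>
      Finsupp.notMem_support_iff.mp fun h => hw (hs h)).symm
  by_cases hm : #A ≤ m + 1
  · have h1 := Finset.card_finsuppAntidiag_nat_eq_choose (s := A) (m + 1 - #A)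
    have h2 : #A + (m + 1 - #A) - 1 = m := by omega
    rw [h2, Nat.choose_symm_of_eq_add (show m = (m + 1 - #A) + (#A - 1) by omega)] at h1
    rw [← h1]
    -- Subtracting the indicator of `A` turns exponents that are positive on all of `A` into
    -- arbitrary exponents on `A`, of degree `m + 1 - #A`.
    set e : W →₀ ℕ := Finsupp.indicator A (fun _ _ => 1) with he
    have heA : ∀ w ∈ A, e w = 1 := fun w hw => by simp [he, hw]
    have heA' : ∀ w ∉ A, e w = 0 := fun w hw => by simp [he, hw]
    refine Finset.card_bij' (fun s _ => s - e) (fun s _ => s + e) ?_ ?_ ?_ ?_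
    · intro s hs
      obtain ⟨hs', rfl⟩ := Finset.mem_filter.1 hs
      rw [Finset.mem_finsuppAntidiag] at hs' ⊢
      have h3 : ∑ w ∈ s.support, (s - e) w + ∑ w ∈ s.support, 1 = ∑ w ∈ s.support, s w := by
        rw [← Finset.sum_add_distrib]
        refine Finset.sum_congr rfl fun w hw => ?_
        rw [Finsupp.tsub_apply, heA w hw]
        have := Finsupp.mem_support_iff.1 hw
        omega
      have h4 := hsum s subset_rfl
      have h5 : ∑ w, s w = m + 1 := hs'.1
      simp only [Finset.sum_const, smul_eq_mul, mul_one] at h3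
      have h6 : ∑ w ∈ s.support, (s - e) w = m + 1 - #s.support := by omega
      refine ⟨h6, fun w hw => ?_⟩
      rw [Finsupp.mem_support_iff, Finsupp.tsub_apply] at hw
      rw [Finsupp.mem_support_iff]
      omega
    · intro s hs
      rw [Finset.mem_finsuppAntidiag] at hs
      have hsupp : (s + e).support = A := by
        ext w
        rw [Finsupp.mem_support_iff, Finsupp.add_apply]
        constructor
        · intro h
          by_contra hw
          rw [heA' w hw, Finsupp.notMem_support_iff.mp fun h' => hw (hs.2 h')] at h
          exact h rfl
        · intro hw
          rw [heA w hw]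
          omega
      rw [Finset.mem_filter, Finset.mem_finsuppAntidiag]
      refine ⟨⟨?_, Finset.subset_univ _⟩, hsupp⟩
      rw [hsum _ hsupp.le]
      have h3 : ∑ w ∈ A, (s + e) w = ∑ w ∈ A, s w + ∑ w ∈ A, 1 := by
        rw [← Finset.sum_add_distrib]
        refine Finset.sum_congr rfl fun w hw => ?_
        rw [Finsupp.add_apply, heA w hw]
      have h4 : ∑ w ∈ A, s w = m + 1 - #A := hs.1
      simp only [Finset.sum_const, smul_eq_mul, mul_one] at h3
      omega
    · intro s hs
      obtain ⟨-, rfl⟩ := Finset.mem_filter.1 hs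
      ext w
      rw [Finsupp.add_apply, Finsupp.tsub_apply]
      by_cases hw : w ∈ s.support
      · have := Finsupp.mem_support_iff.1 hw
        rw [heA w hw]
        omega
      · rw [heA' w hw]
        omega
    · intro s _
      exact add_tsub_cancel_right s e
  · rw [Nat.choose_eq_zero_of_lt (by omega), Finset.card_eq_zero, Finset.filter_eq_empty_iff]
    rintro s hs rfl
    rw [Finset.mem_finsuppAntidiag] at hs
    have h3 : ∑ w ∈ s.support, 1 ≤ ∑ w ∈ s.support, s w :=
      Finset.sum_le_sum fun w hw => Nat.one_le_iff_ne_zero.2 (Finsupp.mem_support_iff.1 hw)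
    have h4 := hsum s subset_rfl
    have h5 : ∑ w, s w = m + 1 := hs.1
    simp only [Finset.sum_const, smul_eq_mul, mul_one] at h3
    omega

/-- Group the monomials by their support. The degree is positive, so the empty face contributes
nothing. -/
theorem ncard_faceMonomials_succ {W : Type*} [Finite W] (K : PreAbstractSimplicialComplex W)
    (m : ℕ) : (K.faceMonomials (m + 1)).ncard =
      ∑ i ∈ range (m + 1), K.fVec (i + 1) * m.choose i := by
  classical
  have := Fintype.ofFinite W
  have hset : K.faceMonomials (m + 1) =
      ({s ∈ (Finset.univ : Finset W).finsuppAntidiag (m + 1) | K.IsFace s.support} :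
        Finset (W →₀ ℕ)) := by
    ext s
    simp [faceMonomials, Finsupp.degree_eq_sum, and_comm]
  rw [hset, Set.ncard_coe_finset]
  set g : ℕ → ℕ := fun a => if a = 0 then 0 else m.choose (a - 1) with hg
  set F : Finset (Finset W) := {A | K.IsFace A} with hF
  have h1 : #{s ∈ (Finset.univ : Finset W).finsuppAntidiag (m + 1) | K.IsFace s.support} =
      ∑ A ∈ F, g #A := by
    rw [Finset.card_eq_sum_card_fiberwise (f := Finsupp.support) (t := F)]
    · refine Finset.sum_congr rfl fun A hA => ?_
      refine Eq.trans ?_ (card_finsuppAntidiag_filter_support_eq A m)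
      rw [Finset.filter_filter]
      congr 1
      refine Finset.filter_congr fun s _ => ⟨fun h => h.2, fun h => ⟨?_, h⟩⟩
      rw [h]
      exact (Finset.mem_filter.1 hA).2
    · intro s hs
      have hs := (Finset.mem_filter.1 hs).2
      simpa [hF] using hs
  have hfv : ∀ i, K.fVec i = #{A ∈ F | #A = i} := by
    intro i
    rw [fVec, ← Set.ncard_coe_finset]
    congr 1
    ext A
    simp [hF]
  have h2 : ∑ A ∈ F, g #A = ∑ A ∈ F with #A ∈ range (m + 2), g #A := by
    refine (Finset.sum_filter_of_ne fun A _ hA => ?_).symm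
    rw [Finset.mem_range]
    by_contra hlt
    refine hA ?_
    simp only [hg]
    rw [if_neg (by omega), Nat.choose_eq_zero_of_lt (by omega)]
  rw [h1, h2,
    ← Finset.sum_fiberwise_of_maps_to (t := range (m + 2)) (g := fun A => #A)
      (fun A hA => (Finset.mem_filter.1 hA).2), Finset.sum_range_succ']
  have h3 : ∀ i ∈ range (m + 2), ∑ A ∈ {A ∈ F | #A ∈ range (m + 2)} with #A = i, g #A =
      K.fVec i * g i := by
    intro i hi
    rw [hfv, ← smul_eq_mul, ← Finset.sum_const, Finset.filter_filter]
    refine Finset.sum_congr (Finset.filter_congr fun A _ => ?_) fun A hA => ?_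
    · exact ⟨fun h => h.2, fun h => ⟨h ▸ hi, h⟩⟩
    · rw [(Finset.mem_filter.1 hA).2]
  rw [h3 0 (by simp)]
  simp only [hg, if_true, mul_zero, add_zero]
  refine Finset.sum_congr rfl fun i hi => ?_
  rw [h3 (i + 1) (by simpa using hi)]
  simp [hg]

/-! ### Monomials of the edgewise subdivision -/

/-- The sum of the first `t` entries of a vector. -/
def partialSum {n : ℕ} (a : Fin n → ℕ) (t : ℕ) : ℕ := ∑ k : Fin n, if k.1 < t then a k else 0

theorem partialSum_zero {n : ℕ} (a : Fin n → ℕ) : partialSum a 0 = 0 := by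
  simp [partialSum]

theorem partialSum_succ {n : ℕ} (a : Fin n → ℕ) (i : Fin n) :
    partialSum a (i.1 + 1) = partialSum a i.1 + a i := by
  have h : a i = ∑ k : Fin n, if k = i then a k else 0 := by simp
  rw [partialSum, partialSum, h, ← Finset.sum_add_distrib]
  refine Finset.sum_congr rfl fun k _ => ?_
  rcases lt_trichotomy k i with hk | rfl | hk
  · have h1 : k.1 < i.1 := hk
    simp [h1, hk.ne, show k.1 < i.1 + 1 by omega]
  · simp
  · have h1 : i.1 < k.1 := hk
    simp [hk.ne', show ¬ k.1 < i.1 + 1 by omega, show ¬ k.1 < i.1 by omega]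

theorem partialSum_self {n : ℕ} (a : Fin n → ℕ) : partialSum a n = ∑ k, a k := by
  simp [partialSum]

theorem partialSum_eq_of_succ {n : ℕ} (a : Fin n → ℕ) (Y : ℕ → ℕ) (h0 : Y 0 = 0)
    (h : ∀ i : Fin n, Y (i.1 + 1) = Y i.1 + a i) : ∀ t ≤ n, partialSum a t = Y t
  | 0, _ => by rw [partialSum_zero, h0]
  | t + 1, ht => by
    have h1 := partialSum_succ a ⟨t, ht⟩
    have h2 := h ⟨t, ht⟩
    have h3 := partialSum_eq_of_succ a Y h0 h t (by omega)
    simp only at h1 h2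
    omega

theorem partialSum_injective {n : ℕ} {a b : Fin n → ℕ}
    (h : ∀ i : Fin n, partialSum a (i.1 + 1) = partialSum b (i.1 + 1)) : a = b := by
  have h' : ∀ i : Fin n, partialSum a i.1 = partialSum b i.1 := by
    rintro ⟨i, hi⟩
    cases i with
    | zero => rw [partialSum_zero, partialSum_zero]
    | succ i => exact h ⟨i, by omega⟩
  funext i
  have h1 := h i
  rw [partialSum_succ, partialSum_succ, h' i] at h1
  omega

theorem edgewiseIota_diff {n r : ℕ} (v w : EdgewiseVertex n r) (i : Fin n) :
    edgewiseIota (v.diff w) i = (partialSum v.1 (i.1 + 1) : ℤ) - partialSum w.1 (i.1 + 1) := by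
  have h : ∀ k : Fin n, edgewiseU k i = if k.1 < i.1 + 1 then 1 else 0 := by
    intro k
    rw [edgewiseU, Finset.sum_apply, Finset.sum_pi_single]
    simp only [Finset.mem_Ici, Nat.lt_succ_iff, Fin.le_def]
  rw [edgewiseIota, Finset.sum_apply, partialSum, partialSum]
  push_cast
  rw [← Finset.sum_sub_distrib]
  refine Finset.sum_congr rfl fun k _ => ?_
  rw [Pi.smul_apply, h, EdgewiseVertex.diff]
  split_ifs <;> simp

/-- `v ≤ w` and `w` exceeds `v` by at most one in each partial sum. -/
def EdgewiseVertex.Below {n r : ℕ} (v w : EdgewiseVertex n r) : Prop :=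
  ∀ i : Fin n, partialSum v.1 (i.1 + 1) ≤ partialSum w.1 (i.1 + 1) ∧
    partialSum w.1 (i.1 + 1) ≤ partialSum v.1 (i.1 + 1) + 1

/-- The adjacency condition of the edgewise subdivision on a set of vertices. -/
def EdgewiseVertex.Compatible {n r : ℕ} (A : Finset (EdgewiseVertex n r)) : Prop :=
  ∀ v ∈ A, ∀ w ∈ A, v.Below w ∨ w.Below v

theorem edgewiseSubdivision_isFace_iff {n r : ℕ} (Δ : PreAbstractSimplicialComplex (Fin n))
    (A : Finset (EdgewiseVertex n r)) : (edgewiseSubdivision Δ r).IsFace A ↔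
      Δ.IsFace (A.biUnion EdgewiseVertex.supp) ∧ EdgewiseVertex.Compatible A := by
  have hb : ∀ v w : EdgewiseVertex n r, v.Below w ↔
      ∀ j, edgewiseIota (w.diff v) j = 0 ∨ edgewiseIota (w.diff v) j = 1 := by
    intro v w
    refine forall_congr' fun i => ?_
    rw [edgewiseIota_diff]
    omega
  have hc : EdgewiseVertex.Compatible A ↔ ∀ v ∈ A, ∀ w ∈ A,
      (∀ j, edgewiseIota (v.diff w) j = 0 ∨ edgewiseIota (v.diff w) j = 1) ∨
      (∀ j, edgewiseIota (w.diff v) j = 0 ∨ edgewiseIota (w.diff v) j = 1) := by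
    refine forall₂_congr fun v _ => forall₂_congr fun w _ => ?_
    rw [hb, hb, or_comm]
  rw [hc]
  constructor
  · rintro (rfl | h)
    · exact ⟨Or.inl (by simp), by simp⟩
    · exact h.2
  · intro h
    rcases A.eq_empty_or_nonempty with rfl | hA
    · exact Or.inl rfl
    · exact Or.inr ⟨hA, h⟩

/-- The weighted sum of a multiset of vertices of the edgewise subdivision. -/
noncomputable def edgewiseTotal {n r : ℕ} (s : EdgewiseVertex n r →₀ ℕ) : Fin n → ℕ :=
  fun i => s.sum fun v c => c * v.1 i

theorem partialSum_edgewiseTotal {n r : ℕ} (s : EdgewiseVertex n r →₀ ℕ) (t : ℕ) :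
    partialSum (edgewiseTotal s) t = s.sum fun v c => c * partialSum v.1 t := by
  simp only [partialSum, edgewiseTotal, Finsupp.sum, Finset.mul_sum]
  rw [Finset.sum_comm]
  refine Finset.sum_congr rfl fun k _ => ?_
  split_ifs <;> simp

theorem sum_edgewiseTotal {n r : ℕ} (s : EdgewiseVertex n r →₀ ℕ) :
    ∑ i, edgewiseTotal s i = s.degree * r := by
  rw [← partialSum_self, partialSum_edgewiseTotal, Finsupp.degree_apply, Finset.sum_mul]
  refine Finset.sum_congr rfl fun v _ => ?_
  simp only [partialSum_self, v.2]

theorem edgewiseTotal_add {n r : ℕ} (s t : EdgewiseVertex n r →₀ ℕ) :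
    edgewiseTotal (s + t) = edgewiseTotal s + edgewiseTotal t := by
  funext i
  simp only [edgewiseTotal, Pi.add_apply]
  rw [Finsupp.sum_add_index'] <;> intros <;> ring

theorem edgewiseTotal_single {n r : ℕ} (v : EdgewiseVertex n r) :
    edgewiseTotal (Finsupp.single v 1) = v.1 := by
  funext i
  simp [edgewiseTotal]

theorem edgewiseTotal_ne_zero_iff {n r : ℕ} (s : EdgewiseVertex n r →₀ ℕ) (i : Fin n) :
    edgewiseTotal s i ≠ 0 ↔ i ∈ s.support.biUnion EdgewiseVertex.supp := by
  rw [edgewiseTotal, Finsupp.sum, Ne, Finset.sum_eq_zero_iff]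
  simp only [Finset.mem_biUnion, EdgewiseVertex.supp, Finset.mem_filter, Finset.mem_univ, true_and,
    not_forall, mul_eq_zero, not_or, Finsupp.mem_support_iff]
  constructor
  · rintro ⟨v, h1, h2⟩
    exact ⟨v, h2⟩
  · rintro ⟨v, h2⟩
    exact ⟨v, h2.1, h2⟩

theorem EdgewiseVertex.Compatible.exists_top {n r : ℕ} {A : Finset (EdgewiseVertex n r)}
    (hA : EdgewiseVertex.Compatible A) (hne : A.Nonempty) : ∃ v ∈ A, ∀ w ∈ A, w.Below v := by
  -- `Below` orders compatible vertices, so a vertex with maximal sum of partial sums is the top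
  -- one.
  obtain ⟨v, hv, hmax⟩ := Finset.exists_max_image A
    (fun v => ∑ i : Fin n, partialSum v.1 (i.1 + 1)) hne
  refine ⟨v, hv, fun w hw => ?_⟩
  rcases hA v hv w hw with h | h
  · have h1 := hmax w hw
    have h2 : ∀ i ∈ (Finset.univ : Finset (Fin n)),
        partialSum v.1 (i.1 + 1) ≤ partialSum w.1 (i.1 + 1) := fun i _ => (h i).1
    have h3 := (Finset.sum_eq_sum_iff_of_le h2).1 (le_antisymm (Finset.sum_le_sum h2) h1)
    intro i
    have := h3 i (Finset.mem_univ i)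
    omega
  · exact h

/-- The top vertex of a compatible multiset is determined by the weighted sum. -/
theorem EdgewiseVertex.Compatible.partialSum_top {n r : ℕ} {s : EdgewiseVertex n r →₀ ℕ}
    {v : EdgewiseVertex n r} (hv : v ∈ s.support) (htop : ∀ w ∈ s.support, w.Below v)
    (i : Fin n) : partialSum v.1 (i.1 + 1) =
      (partialSum (edgewiseTotal s) (i.1 + 1) + (s.degree - 1)) / s.degree := by
  have hpos : 0 < s.degree := by
    rw [Finsupp.degree_apply]
    exact Finset.sum_pos (fun w hw => Nat.pos_of_ne_zero (Finsupp.mem_support_iff.1 hw)) ⟨v, hv⟩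
  rw [partialSum_edgewiseTotal, Finsupp.sum]
  set b := partialSum v.1 (i.1 + 1)
  have h1 : ∑ w ∈ s.support, s w * partialSum w.1 (i.1 + 1) ≤ s.degree * b := by
    rw [Finsupp.degree_apply, Finset.sum_mul]
    exact Finset.sum_le_sum fun w hw => Nat.mul_le_mul_left _ (htop w hw i).1
  have h2 : s.degree * b + 1 ≤
      ∑ w ∈ s.support, s w * partialSum w.1 (i.1 + 1) + s.degree := by
    rw [Finsupp.degree_apply, Finset.sum_mul, ← Finset.sum_add_distrib, Nat.succ_le_iff]
    refine Finset.sum_lt_sum (fun w hw => ?_) ⟨v, hv, ?_⟩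
    · have := Nat.mul_le_mul_left (s w) (htop w hw i).2
      rw [mul_add, mul_one] at this
      exact this
    · have := Nat.pos_of_ne_zero (Finsupp.mem_support_iff.1 hv)
      exact Nat.lt_add_of_pos_right this
  -- The total lies in `(degree * (b - 1), degree * b]`: no vertex exceeds the top or falls more
  -- than one below it, and the top itself occurs. Hence `b` is the average rounded up.
  symm
  rw [Nat.div_eq_iff hpos]
  rw [mul_comm] at h1 h2
  constructor <;> omega

/-- The top vertex can be read off from the total and the degree, so both multisets share it; remove
one copy and induct. -/
theorem edgewiseTotal_injOn {n r : ℕ} (m : ℕ) : ∀ s t : EdgewiseVertex n r →₀ ℕ,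
    EdgewiseVertex.Compatible s.support → EdgewiseVertex.Compatible t.support →
    s.degree = m → t.degree = m → edgewiseTotal s = edgewiseTotal t → s = t := by
  induction m with
  | zero =>
    intro s t _ _ hs ht _
    rw [Finsupp.degree_eq_zero_iff] at hs ht
    rw [hs, ht]
  | succ m ih =>
    intro s t hs ht hsm htm hst
    have hne : ∀ s : EdgewiseVertex n r →₀ ℕ, s.degree = m + 1 → s.support.Nonempty := by
      intro s hs
      rw [Finsupp.support_nonempty_iff]
      rintro rfl
      simp at hs
    obtain ⟨v, hv, hvt⟩ := hs.exists_top (hne s hsm)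
    obtain ⟨w, hw, hwt⟩ := ht.exists_top (hne t htm)
    have hvw : v = w := by
      refine Subtype.ext (partialSum_injective fun i => ?_)
      rw [EdgewiseVertex.Compatible.partialSum_top hv hvt,
        EdgewiseVertex.Compatible.partialSum_top hw hwt, hsm, htm, hst]
    subst hvw
    have key : ∀ s : EdgewiseVertex n r →₀ ℕ, v ∈ s.support →
        s - Finsupp.single v 1 + Finsupp.single v 1 = s := by
      intro s hv
      refine tsub_add_cancel_of_le ?_
      rw [Finsupp.single_le_iff]
      exact Nat.one_le_iff_ne_zero.2 (Finsupp.mem_support_iff.1 hv)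
    have hdeg : ∀ s : EdgewiseVertex n r →₀ ℕ, v ∈ s.support → s.degree = m + 1 →
        (s - Finsupp.single v 1).degree = m := by
      intro s hv hs
      have h1 := congrArg Finsupp.degree (key s hv)
      rw [map_add, Finsupp.degree_single, hs] at h1
      omega
    have hsub : ∀ s : EdgewiseVertex n r →₀ ℕ, EdgewiseVertex.Compatible s.support →
        EdgewiseVertex.Compatible (s - Finsupp.single v 1).support := by
      intro s hs a ha b hb
      have hle : (s - Finsupp.single v 1).support ⊆ s.support :=
        Finsupp.support_mono tsub_le_self
      exact hs a (hle ha) b (hle hb)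
    rw [← key s hv, ← key t hw]
    congr 1
    refine ih _ _ (hsub s hs) (hsub t ht) (hdeg s hv hsm) (hdeg t hw htm) ?_
    rw [← key s hv, ← key t hw, edgewiseTotal_add, edgewiseTotal_add] at hst
    exact add_right_cancel hst

/-- Hermite's identity: raising `Y` by one shifts the window, replacing `Y / m` by `(Y + m) / m = Y
/ m + 1`. -/
theorem sum_range_add_div (m : ℕ) (hm : 0 < m) (Y : ℕ) :
    ∑ j ∈ range m, (Y + j) / m = Y := by
  induction Y with
  | zero => exact Finset.sum_eq_zero fun j hj => Nat.div_eq_of_lt (by simpa using hj)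
  | succ Y ih =>
    have h1 := Finset.sum_range_succ (fun j => (Y + j) / m) m
    have h2 := Finset.sum_range_succ' (fun j => (Y + j) / m) m
    rw [h1, ih, Nat.add_div_right _ hm] at h2
    have h3 : ∀ j, (Y + (j + 1)) / m = (Y + 1 + j) / m := fun j => by
      rw [add_assoc Y 1 j, add_comm 1 j]
    rw [Finset.sum_congr rfl fun j _ => h3 j, add_zero] at h2
    omega

theorem exists_edgewiseTotal_eq {n r m : ℕ} (hm : 0 < m) (a : Fin n → ℕ)
    (ha : ∑ i, a i = m * r) : ∃ s : EdgewiseVertex n r →₀ ℕ,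
      EdgewiseVertex.Compatible s.support ∧ s.degree = m ∧ edgewiseTotal s = a := by
  classical
  have hmono : ∀ j (i : Fin n), (partialSum a i.1 + j) / m ≤ (partialSum a (i.1 + 1) + j) / m :=
    fun j i => Nat.div_le_div_right (by rw [partialSum_succ]; omega)
  -- Spread `a` evenly: the `j`-th vertex has partial sums `⌊(S + j) / m⌋`, where `S` is that of
  -- `a`. These increase with `j`, differ by at most one for `j < m`, and add up to `S` by Hermite's
  -- identity.
  set y : ℕ → Fin n → ℕ := fun j i =>
    (partialSum a (i.1 + 1) + j) / m - (partialSum a i.1 + j) / m with hy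
  have hps : ∀ j < m, ∀ t ≤ n, partialSum (y j) t = (partialSum a t + j) / m := by
    intro j hj
    refine partialSum_eq_of_succ (y j) (fun t => (partialSum a t + j) / m) ?_ ?_
    · simp only [partialSum_zero, zero_add]
      exact Nat.div_eq_of_lt hj
    · intro i
      have := hmono j i
      simp only [hy]
      omega
  have hyr : ∀ j : Fin m, ∑ i, y j i = r := by
    intro j
    rw [← partialSum_self, hps j j.2 n le_rfl, partialSum_self, ha, Nat.mul_add_div hm,
      Nat.div_eq_of_lt j.2, add_zero]
  set V : Fin m → EdgewiseVertex n r := fun j => ⟨y j, hyr j⟩ with hV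
  have hbelow : ∀ j k : Fin m, j ≤ k → (V j).Below (V k) := by
    intro j k hjk i
    have hjk' : j.1 ≤ k.1 := hjk
    have hk := k.2
    simp only [hV]
    rw [hps j j.2 _ i.2, hps k k.2 _ i.2, ← Nat.add_div_right _ hm]
    exact ⟨Nat.div_le_div_right (by omega), Nat.div_le_div_right (by omega)⟩
  refine ⟨∑ j, Finsupp.single (V j) 1, ?_, ?_, ?_⟩
  · have hmem : ∀ v ∈ (∑ j, Finsupp.single (V j) 1 : EdgewiseVertex n r →₀ ℕ).support,
        ∃ j, v = V j := by
      intro v hv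
      by_contra! hne
      refine Finsupp.mem_support_iff.1 hv ?_
      rw [Finsupp.finsetSum_apply]
      exact Finset.sum_eq_zero fun j _ => Finsupp.single_eq_of_ne (hne j)
    intro v hv w hw
    obtain ⟨j, rfl⟩ := hmem v hv
    obtain ⟨k, rfl⟩ := hmem w hw
    exact (le_total j k).imp (hbelow j k) (hbelow k j)
  · simp [map_sum]
  · have htot : ∀ S : Finset (Fin m), edgewiseTotal (∑ j ∈ S, Finsupp.single (V j) 1) =
        ∑ j ∈ S, y j := by
      intro S
      induction S using Finset.induction_on with
      | empty => funext i; simp [edgewiseTotal]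
      | insert j S hj ih =>
        rw [Finset.sum_insert hj, Finset.sum_insert hj, edgewiseTotal_add, edgewiseTotal_single, ih]
    refine partialSum_injective fun i => ?_
    rw [htot, partialSum]
    have h1 : ∀ k : Fin n, (if k.1 < i.1 + 1 then (∑ j : Fin m, y j) k else 0) =
        ∑ j : Fin m, if k.1 < i.1 + 1 then y j k else 0 := by
      intro k
      split_ifs <;> simp
    rw [Finset.sum_congr rfl fun k _ => h1 k, Finset.sum_comm]
    have h2 : ∀ j : Fin m, (∑ k : Fin n, if k.1 < i.1 + 1 then y j k else 0) =
        (partialSum a (i.1 + 1) + j) / m := fun j => hps j j.2 _ i.2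
    rw [Finset.sum_congr rfl fun j _ => h2 j,
      Fin.sum_univ_eq_sum_range (fun j => (partialSum a (i.1 + 1) + j) / m) m,
      sum_range_add_div m hm]

theorem ncard_faceMonomials_edgewiseSubdivision {n : ℕ} (Δ : PreAbstractSimplicialComplex (Fin n))
    (r : ℕ) {m : ℕ} (hm : 0 < m) : ((edgewiseSubdivision Δ r).faceMonomials m).ncard =
      (Δ.faceMonomials (m * r)).ncard := by
  have hsupp : ∀ s : EdgewiseVertex n r →₀ ℕ,
      (Finsupp.equivFunOnFinite.symm (edgewiseTotal s)).support =
        s.support.biUnion EdgewiseVertex.supp := by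
    intro s
    ext i
    rw [← edgewiseTotal_ne_zero_iff, Finsupp.mem_support_iff]
    rfl
  refine Set.BijOn.ncard_eq (f := fun s => Finsupp.equivFunOnFinite.symm (edgewiseTotal s))
    ⟨?_, ?_, ?_⟩
  · rintro s ⟨hs, rfl⟩
    refine ⟨?_, ?_⟩
    · rw [hsupp]
      exact ((edgewiseSubdivision_isFace_iff Δ _).1 hs).1
    · rw [← sum_edgewiseTotal, Finsupp.degree_eq_sum]
      rfl
  · rintro s ⟨hs, hsm⟩ t ⟨ht, htm⟩ hst
    exact edgewiseTotal_injOn m s t ((edgewiseSubdivision_isFace_iff Δ _).1 hs).2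
      ((edgewiseSubdivision_isFace_iff Δ _).1 ht).2 hsm htm
      (Finsupp.equivFunOnFinite.symm.injective hst)
  · rintro a ⟨ha, ham⟩
    obtain ⟨s, hs, hsm, hsa⟩ := exists_edgewiseTotal_eq (r := r) hm (a : Fin n → ℕ)
      (by rw [← ham, Finsupp.degree_eq_sum])
    have hsa' : Finsupp.equivFunOnFinite.symm (edgewiseTotal s) = a := by
      rw [hsa]
      exact Finsupp.equivFunOnFinite.symm_apply_apply a
    refine ⟨s, ⟨(edgewiseSubdivision_isFace_iff Δ _).2 ⟨?_, hs⟩, hsm⟩, hsa'⟩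
    rw [← hsupp, hsa']
    exact ha

/-! ### Power sums and the binomial transform -/

/-- The polynomials with `∑ m, m ^ l * x ^ m = E_l (x / (1 - x))`. -/
noncomputable def powerSumPoly : ℕ → ℝ[X]
  | 0 => X
  | l + 1 => X * (1 + X) * derivative (powerSumPoly l)

theorem coeff_powerSumPoly_succ (l i : ℕ) : (powerSumPoly (l + 1)).coeff (i + 1) =
    (i + 1) * (powerSumPoly l).coeff (i + 1) + i * (powerSumPoly l).coeff i := by
  rw [powerSumPoly, mul_assoc, coeff_X_mul, add_mul, one_mul, coeff_add, coeff_derivative]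
  cases i with
  | zero => simp
  | succ i =>
    rw [coeff_X_mul, coeff_derivative]
    push_cast
    ring

theorem coeff_zero_powerSumPoly (l : ℕ) : (powerSumPoly l).coeff 0 = 0 := by
  cases l <;> simp [powerSumPoly, mul_assoc]

theorem coeff_powerSumPoly_eq_zero (l : ℕ) : ∀ i, l + 1 < i → (powerSumPoly l).coeff i = 0 := by
  induction l with
  | zero =>
    intro i hi
    rw [powerSumPoly, coeff_X, if_neg (by omega)]
  | succ l ih =>
    rintro (_ | i) hi
    · omega
    · rw [coeff_powerSumPoly_succ, ih _ (by omega), ih _ (by omega)]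
      simp

theorem natDegree_powerSumPoly_le (l : ℕ) : (powerSumPoly l).natDegree ≤ l + 1 :=
  natDegree_le_iff_coeff_eq_zero.2 (coeff_powerSumPoly_eq_zero l)

theorem coeff_powerSumPoly_self (l : ℕ) : (powerSumPoly l).coeff (l + 1) = l.factorial := by
  induction l with
  | zero => simp [powerSumPoly]
  | succ l ih =>
    rw [coeff_powerSumPoly_succ, coeff_powerSumPoly_eq_zero l _ (by omega), ih, Nat.factorial_succ]
    push_cast
    ring

theorem powerSumPoly_ne_zero (l : ℕ) : powerSumPoly l ≠ 0 := by
  intro h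
  have := coeff_powerSumPoly_self l
  rw [h, coeff_zero] at this
  exact Nat.factorial_ne_zero l (by exact_mod_cast this.symm)

/-- This is the generating function identity compared at `x ^ (m + 1)`, where `(x / (1 - x)) ^ (i +
1)` has coefficient `m.choose i`. -/
theorem sum_coeff_powerSumPoly_mul_choose (l m : ℕ) :
    ∑ i ∈ range (m + 1), (powerSumPoly l).coeff (i + 1) * m.choose i = ((m : ℝ) + 1) ^ l := by
  induction l with
  | zero =>
    rw [Finset.sum_eq_single 0]
    · simp [powerSumPoly]
    · intro i _ hi
      simp [powerSumPoly, coeff_X, hi]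
    · simp
  | succ l ih =>
    set c := (powerSumPoly l).coeff
    -- An index shift whose boundary terms vanish: one has the factor `i = 0`, the other `m.choose
    -- (m + 1) = 0`.
    have h1 : ∑ i ∈ range (m + 1), ((i : ℝ) + 1) * c (i + 1) * m.choose (i + 1) =
        ∑ i ∈ range (m + 1), (i : ℝ) * c i * m.choose i := by
      have h2 := Finset.sum_range_succ (fun i : ℕ => (i : ℝ) * c i * m.choose i) (m + 1)
      have h3 := Finset.sum_range_succ' (fun i : ℕ => (i : ℝ) * c i * m.choose i) (m + 1)
      rw [h2] at h3
      simpa using h3.symm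
    rw [pow_succ, ← ih, Finset.sum_mul]
    have h4 : ∀ i ∈ range (m + 1), c (i + 1) * (m.choose i : ℝ) * ((m : ℝ) + 1) =
        (i + 1) * c (i + 1) * m.choose i + (i + 1) * c (i + 1) * m.choose (i + 1) := by
      intro i _
      have h5 := Nat.add_one_mul_choose_eq m i
      rw [Nat.choose_succ_succ'] at h5
      have h6 : ((m : ℝ) + 1) * m.choose i = (m.choose i + m.choose (i + 1)) * (i + 1) := by
        exact_mod_cast h5
      linear_combination c (i + 1) * h6
    rw [Finset.sum_congr rfl h4, Finset.sum_add_distrib, h1, ← Finset.sum_add_distrib]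
    refine Finset.sum_congr rfl fun i _ => ?_
    rw [coeff_powerSumPoly_succ]
    ring

/-- The system is triangular with diagonal entries `m.choose m = 1`. -/
theorem eq_of_sum_mul_choose_eq {a b : ℕ → ℝ}
    (h : ∀ m : ℕ, ∑ i ∈ range (m + 1), a i * m.choose i = ∑ i ∈ range (m + 1), b i * m.choose i)
    (m : ℕ) : a m = b m := by
  induction m using Nat.strong_induction_on with
  | _ m ih =>
    have h1 := h m
    rw [Finset.sum_range_succ, Finset.sum_range_succ,
      Finset.sum_congr rfl fun i hi => by rw [ih i (Finset.mem_range.1 hi)]] at h1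
    simpa using h1

/-! ### The Hilbert polynomial and the `f`-polynomial of the Veronese -/

/-- The Hilbert polynomial `∑ f_j * (x - 1).choose j` of the Stanley-Reisner ring of a complex of
dimension `D` with `f`-vector `f`. -/
noncomputable def faceHilbertPoly (f : ℕ → ℕ) (D : ℕ) : ℝ[X] :=
  ∑ j ∈ range (D + 1), C ((f (j + 1) : ℝ) / j.factorial) * (descPochhammer ℝ j).comp (X - C 1)

theorem natDegree_descPochhammer_comp (j : ℕ) :
    ((descPochhammer ℝ j).comp (X - C 1)).natDegree = j := by
  rw [natDegree_comp, natDegree_X_sub_C, mul_one, descPochhammer_natDegree]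

theorem natDegree_faceHilbertPoly_le (f : ℕ → ℕ) (D : ℕ) : (faceHilbertPoly f D).natDegree ≤ D := by
  refine natDegree_sum_le_of_forall_le _ _ fun j hj => ?_
  refine (natDegree_C_mul_le _ _).trans ?_
  rw [natDegree_descPochhammer_comp]
  exact Nat.lt_succ_iff.1 (Finset.mem_range.1 hj)

theorem coeff_faceHilbertPoly_self (f : ℕ → ℕ) (D : ℕ) :
    (faceHilbertPoly f D).coeff D = f (D + 1) / D.factorial := by
  rw [faceHilbertPoly, finsetSum_coeff, Finset.sum_range_succ, Finset.sum_eq_zero, zero_add, coeff_C_mul]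
  · have h : ((descPochhammer ℝ D).comp (X - C 1)).Monic :=
      (monic_descPochhammer ℝ D).comp (monic_X_sub_C 1) (by rw [natDegree_X_sub_C]; exact one_ne_zero)
    have h1 := h.coeff_natDegree
    rw [natDegree_descPochhammer_comp] at h1
    rw [h1, mul_one]
  · intro j hj
    rw [coeff_C_mul, coeff_eq_zero_of_natDegree_lt, mul_zero]
    rw [natDegree_descPochhammer_comp]
    exact Finset.mem_range.1 hj

theorem eval_faceHilbertPoly (f : ℕ → ℕ) (D M : ℕ) : (faceHilbertPoly f D).eval ((M : ℝ) + 1) =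
    ∑ j ∈ range (D + 1), (f (j + 1) : ℝ) * M.choose j := by
  rw [faceHilbertPoly, eval_finsetSum]
  refine Finset.sum_congr rfl fun j _ => ?_
  rw [eval_mul, eval_C, eval_comp, eval_sub, eval_X, eval_C, add_sub_cancel_right,
    descPochhammer_eval_eq_descFactorial, Nat.descFactorial_eq_factorial_mul_choose]
  have := Nat.factorial_ne_zero j
  push_cast
  field_simp

/-- Positivity of `M` matters: in degree `0` there is one monomial, while the polynomial takes an
Euler characteristic as its value. -/
theorem ncard_faceMonomials_eq_eval_faceHilbertPoly {W : Type*} [Finite W]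
    {K : PreAbstractSimplicialComplex W} {D : ℕ} (hK : K.HasDim D) {M : ℕ} (hM : 0 < M) :
    ((K.faceMonomials M).ncard : ℝ) = (faceHilbertPoly K.fVec D).eval (M : ℝ) := by
  obtain ⟨M, rfl⟩ : ∃ N, M = N + 1 := ⟨M - 1, by omega⟩
  rw [ncard_faceMonomials_succ, Nat.cast_succ, eval_faceHilbertPoly]
  push_cast
  -- Both sums extend to this common range: face numbers vanish above `D`, binomial coefficients
  -- above the upper index.
  set T := range (max D M + 1)
  have h1 : ∀ N ≤ max D M, (∀ j, N < j → (K.fVec (j + 1) : ℝ) * M.choose j = 0) →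
      ∑ j ∈ range (N + 1), (K.fVec (j + 1) : ℝ) * M.choose j =
        ∑ j ∈ T, (K.fVec (j + 1) : ℝ) * M.choose j := by
    intro N hN h0
    refine Finset.sum_subset (Finset.range_subset_range.2 (by omega)) fun j _ hj => h0 j ?_
    rw [Finset.mem_range] at hj
    omega
  rw [h1 M (le_max_right _ _), h1 D (le_max_left _ _)]
  · intro j hj
    rw [K.fVec_eq_zero_of_card_lt, Nat.cast_zero, zero_mul]
    intro s hs
    have := hK.2 s hs
    omega
  · intro j hj
    rw [Nat.choose_eq_zero_of_lt hj, Nat.cast_zero, mul_zero]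

/-- The `f`-polynomial of a complex whose Hilbert function is `m ↦ p (r * m)`. -/
noncomputable def veroneseFPoly (p : ℝ[X]) (D : ℕ) (r : ℕ) : ℝ[X] :=
  1 + ∑ l ∈ range (D + 1), C (p.coeff l * (r : ℝ) ^ l) * powerSumPoly l

theorem natDegree_veroneseFPoly_le (p : ℝ[X]) (D r : ℕ) :
    (veroneseFPoly p D r).natDegree ≤ D + 1 := by
  refine natDegree_add_le_of_degree_le (by simp) (natDegree_sum_le_of_forall_le _ _ fun l hl => ?_)
  refine (natDegree_C_mul_le _ _).trans ((natDegree_powerSumPoly_le l).trans ?_)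
  have := Finset.mem_range.1 hl
  omega

theorem coeff_zero_veroneseFPoly (p : ℝ[X]) (D r : ℕ) : (veroneseFPoly p D r).coeff 0 = 1 := by
  simp [veroneseFPoly, finsetSum_coeff, coeff_zero_powerSumPoly]

/-- Both sequences have the same binomial transform, namely the Hilbert polynomial at `(m + 1) * r`
expanded in powers of `m + 1`. -/
theorem coeff_veroneseFPoly_eq_fVec {W V : Type*} [Finite W] [Finite V]
    {K : PreAbstractSimplicialComplex W} {D : ℕ} (hK : K.HasDim D)
    (Γ : PreAbstractSimplicialComplex V) {r : ℕ} (hr : 0 < r)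
    (h : ∀ m, 0 < m → (Γ.faceMonomials m).ncard = (K.faceMonomials (m * r)).ncard) (i : ℕ) :
    (veroneseFPoly (faceHilbertPoly K.fVec D) D r).coeff i = Γ.fVec i := by
  cases i with
  | zero => rw [coeff_zero_veroneseFPoly, fVec_zero, Nat.cast_one]
  | succ i =>
    refine eq_of_sum_mul_choose_eq
      (a := fun i => (veroneseFPoly (faceHilbertPoly K.fVec D) D r).coeff (i + 1))
      (b := fun i => (Γ.fVec (i + 1) : ℝ)) (fun m => ?_) i
    have h1 := ncard_faceMonomials_succ Γ m
    rw [h (m + 1) (by omega)] at h1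
    have h2 := ncard_faceMonomials_eq_eval_faceHilbertPoly hK (M := (m + 1) * r) (by positivity)
    rw [h1, eval_eq_sum_range' (Nat.lt_succ_iff.2 (natDegree_faceHilbertPoly_le _ _))] at h2
    push_cast at h2
    rw [h2]
    simp only [veroneseFPoly, coeff_add, coeff_one, Nat.succ_ne_zero, if_false, zero_add,
      finsetSum_coeff, coeff_C_mul, Finset.sum_mul]
    rw [Finset.sum_comm]
    refine Finset.sum_congr rfl fun l _ => ?_
    rw [mul_pow, ← sum_coeff_powerSumPoly_mul_choose, Finset.sum_mul, Finset.mul_sum]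
    refine Finset.sum_congr rfl fun j _ => ?_
    ring

/-! ### Simple roots of the limit and their persistence -/

theorem lt_of_lt_succ {z : ℕ → ℝ} {D : ℕ} (hz : ∀ i < D, z i < z (i + 1)) {i j : ℕ} (hij : i < j)
    (hj : j ≤ D) : z i < z j := by
  induction j, hij using Nat.le_induction with
  | base => exact hz i hj
  | succ j hij ih => exact (ih (by omega)).trans (hz j hj)

/-- By Rolle the derivative vanishes between consecutive roots; the factor `X * (1 + X)` in the
recursion restores the endpoints `-1` and `0`. -/
theorem exists_roots_powerSumPoly (D : ℕ) : ∃ z : ℕ → ℝ, z 0 = -1 ∧ z (D + 1) = 0 ∧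
    (∀ i < D + 1, z i < z (i + 1)) ∧ ∀ i ≤ D + 1, (powerSumPoly (D + 1)).eval (z i) = 0 := by
  induction D with
  | zero =>
    refine ⟨fun i => i - 1, by simp, by simp, fun i _ => by simp, fun i hi => ?_⟩
    interval_cases i <;> simp [powerSumPoly]
  | succ D ih =>
    obtain ⟨z, hz0, hzD, hlt, hroot⟩ := ih
    have hw : ∀ i, ∃ w, i < D + 1 → z i < w ∧ w < z (i + 1) ∧
        (derivative (powerSumPoly (D + 1))).eval w = 0 := by
      intro i
      by_cases hi : i < D + 1
      · obtain ⟨w, hw, hw'⟩ := exists_deriv_eq_zero (f := fun x => (powerSumPoly (D + 1)).eval x)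
          (hlt i hi) (Polynomial.continuous _).continuousOn
          (by simp only [hroot i (by omega), hroot (i + 1) (by omega)])
        rw [Polynomial.deriv] at hw'
        exact ⟨w, fun _ => ⟨hw.1, hw.2, hw'⟩⟩
      · exact ⟨0, fun h => absurd h hi⟩
    choose w hw using hw
    have hev : ∀ x, (powerSumPoly (D + 2)).eval x =
        x * (1 + x) * (derivative (powerSumPoly (D + 1))).eval x := by
      intro x
      rw [powerSumPoly]
      simp
    refine ⟨fun i => if i = 0 then -1 else if i = D + 2 then 0 else w (i - 1), by simp, by simp,
      ?_, ?_⟩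
    · intro i hi
      rcases i with _ | i
      · have := hw 0 (by omega)
        rw [hz0] at this
        simpa using this.1
      · have h1 := hw i (by omega)
        rcases Nat.lt_or_ge (i + 1) (D + 1) with h | h
        · have h2 := hw (i + 1) h
          simpa [show i + 1 ≠ D + 2 by omega, show i ≠ D by omega, show i ≠ D + 1 by omega]
            using h1.2.1.trans h2.1
        · obtain rfl : i = D := by omega
          rw [hzD] at h1
          simpa using h1.2.1
    · intro i hi
      rw [hev]
      rcases i with _ | i
      · simp
      · by_cases h : i = D + 1
        · simp [h]
        · have h1 := hw i (by omega)
          simp [h, h1.2.2]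

/-- A polynomial of degree at most `#s` with `#s` distinct roots has only simple roots. -/
theorem eval_derivative_ne_zero_of_natDegree_le_card {K : Type*} [Field K] {p : K[X]} (hp : p ≠ 0)
    {s : Finset K} (hs : p.natDegree ≤ #s) (hroot : ∀ x ∈ s, p.eval x = 0) {x : K} (hx : x ∈ s) :
    (derivative p).eval x ≠ 0 := by
  classical
  intro h
  have h1 : 1 < p.rootMultiplicity x :=
    (one_lt_rootMultiplicity_iff_isRoot hp).2 ⟨hroot x hx, h⟩
  have h2 : s.val ≤ p.roots :=
    (Multiset.le_iff_subset s.nodup).2 fun y hy => (mem_roots hp).2 (hroot y hy)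
  have h3 : s.val = p.roots :=
    Multiset.eq_of_le_of_card_le h2 ((card_roots' p).trans hs)
  have h4 : p.roots.count x ≤ 1 := Multiset.nodup_iff_count_le_one.1 (h3 ▸ s.nodup) x
  rw [count_roots] at h4
  omega

theorem exists_neg_mul_of_simple_root {q : ℝ[X]} {z : ℝ} (hz : q.eval z = 0)
    (hz' : (derivative q).eval z ≠ 0) {ε : ℝ} (hε : 0 < ε) :
    ∃ a b, a ≤ b ∧ z - ε < a ∧ b < z + ε ∧ q.eval a * q.eval b < 0 := by
  -- The cofactor `s` of `X - z` is nonzero at `z`, so it keeps its sign nearby while `X - z`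
  -- changes sign.
  obtain ⟨s, rfl⟩ := dvd_iff_isRoot.2 hz
  have hs : s.eval z ≠ 0 := by simpa using hz'
  have hc : Tendsto (fun x => s.eval x * s.eval z) (𝓝 z) (𝓝 (s.eval z * s.eval z)) :=
    (s.continuous.tendsto z).mul_const _
  obtain ⟨δ, hδ, hball⟩ := Metric.eventually_nhds_iff.1
    (hc.eventually_const_lt (mul_self_pos.2 hs))
  set η := min δ ε / 2 with hη
  have hη0 : 0 < η := by positivity
  have h1 : η < δ := by have := min_le_left δ ε; linarith
  have h2 : η < ε := by have := min_le_right δ ε; linarith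
  refine ⟨z - η, z + η, by linarith, by linarith, by linarith, ?_⟩
  have ha : 0 < s.eval (z - η) * s.eval z := hball (by
    rw [Real.dist_eq, show z - η - z = -η by ring, abs_neg, abs_of_pos hη0]
    exact h1)
  have hb : 0 < s.eval (z + η) * s.eval z := hball (by
    rw [Real.dist_eq, show z + η - z = η by ring, abs_of_pos hη0]
    exact h1)
  have hab : 0 < s.eval (z - η) * s.eval (z + η) := by
    by_contra! hle
    have h3 := mul_pos ha hb
    have h4 := mul_nonneg (neg_nonneg.2 hle) (mul_self_nonneg (s.eval z))
    linarith
  simp only [eval_mul, eval_sub, eval_X, eval_C]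
  have h3 : 0 < η * η * (s.eval (z - η) * s.eval (z + η)) := by positivity
  linarith

/-- A simple root of the pointwise limit of polynomials is a limit of roots. -/
theorem exists_tendsto_root {F : ℕ → ℝ[X]} {c : ℕ → ℝ} {q : ℝ[X]}
    (hF : ∀ x, Tendsto (fun r => (F r).eval x * c r) atTop (𝓝 (q.eval x))) {z : ℝ}
    (hz : q.eval z = 0) (hz' : (derivative q).eval z ≠ 0) :
    ∃ x : ℕ → ℝ, Tendsto x atTop (𝓝 z) ∧ ∀ᶠ r in atTop, (F r).eval (x r) = 0 := by
  have hex : ∀ ε > 0, ∀ᶠ r in atTop, ∃ y, dist z y < ε ∧ (F r).eval y = 0 := by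
    intro ε hε
    obtain ⟨a, b, hab, ha, hb, hneg⟩ := exists_neg_mul_of_simple_root hz hz' hε
    filter_upwards [((hF a).mul (hF b)).eventually_lt_const hneg] with r hr
    have h0 : (0 : ℝ) ∈ Set.uIcc ((F r).eval a) ((F r).eval b) := by
      have h1 : (F r).eval a * (F r).eval b < 0 := by
        by_contra! hge
        have := mul_nonneg hge (mul_self_nonneg (c r))
        linarith
      rw [Set.mem_uIcc]
      rcases mul_neg_iff.1 h1 with h | h
      · exact Or.inr ⟨h.2.le, h.1.le⟩
      · exact Or.inl ⟨h.1.le, h.2.le⟩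
    obtain ⟨y, hy, hy0⟩ := intermediate_value_uIcc (F r).continuous.continuousOn h0
    rw [Set.uIcc_of_le hab] at hy
    refine ⟨y, ?_, hy0⟩
    rw [Real.dist_eq, abs_lt]
    constructor <;> linarith [hy.1, hy.2]
  -- Taking the root nearest to `z` gives one sequence that serves every `ε`; the value is arbitrary
  -- when there is no root.
  have hnear : ∀ r, ∃ x, (∃ y, (F r).eval y = 0) →
      (F r).eval x = 0 ∧ ∀ y, (F r).eval y = 0 → dist z x ≤ dist z y := by
    intro r
    by_cases hne : ∃ y, (F r).eval y = 0
    · have hcl : IsClosed {y | (F r).eval y = 0} :=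
        isClosed_eq (F r).continuous continuous_const
      obtain ⟨x, hx, hx'⟩ := hcl.exists_infDist_eq_dist hne z
      exact ⟨x, fun _ => ⟨hx, fun y hy => hx' ▸ Metric.infDist_le_dist_of_mem hy⟩⟩
    · exact ⟨0, fun h => absurd h hne⟩
  choose x hx using hnear
  refine ⟨x, Metric.tendsto_nhds.2 fun ε hε => ?_, ?_⟩
  · filter_upwards [hex ε hε] with r hr
    obtain ⟨y, hy, hy0⟩ := hr
    rw [dist_comm]
    exact ((hx r ⟨y, hy0⟩).2 y hy0).trans_lt hy
  · filter_upwards [hex 1 one_pos] with r hr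
    obtain ⟨y, -, hy0⟩ := hr
    exact (hx r ⟨y, hy0⟩).1

theorem tendsto_eval_veroneseFPoly (p : ℝ[X]) {D : ℕ} (hD : 0 < D) (x : ℝ) :
    Tendsto (fun r : ℕ => (veroneseFPoly p D r).eval x * ((r : ℝ) ^ D)⁻¹) atTop
      (𝓝 ((C (p.coeff D) * powerSumPoly D).eval x)) := by
  have hlow : ∀ l < D, Tendsto (fun r : ℕ => (r : ℝ) ^ l * ((r : ℝ) ^ D)⁻¹) atTop (𝓝 0) :=
    fun l hl => (tendsto_pow_div_pow_atTop_zero (𝕜 := ℝ) hl).comp tendsto_natCast_atTop_atTop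
  have htop : Tendsto (fun r : ℕ => (r : ℝ) ^ D * ((r : ℝ) ^ D)⁻¹) atTop (𝓝 1) := by
    refine tendsto_const_nhds.congr' ?_
    filter_upwards [eventually_gt_atTop 0] with r hr
    rw [mul_inv_cancel₀ (by positivity)]
  have hev : ∀ r : ℕ, (veroneseFPoly p D r).eval x * ((r : ℝ) ^ D)⁻¹ =
      (r : ℝ) ^ 0 * ((r : ℝ) ^ D)⁻¹ +
        (∑ l ∈ range D, p.coeff l * (powerSumPoly l).eval x * ((r : ℝ) ^ l * ((r : ℝ) ^ D)⁻¹) +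
          p.coeff D * (powerSumPoly D).eval x * ((r : ℝ) ^ D * ((r : ℝ) ^ D)⁻¹)) := by
    intro r
    rw [veroneseFPoly, eval_add, eval_finsetSum, Finset.sum_range_succ, eval_one, add_mul, add_mul,
      Finset.sum_mul]
    simp only [eval_mul, eval_C]
    rw [pow_zero]
    refine congrArg₂ _ rfl (congrArg₂ _ (Finset.sum_congr rfl fun l _ => ?_) ?_) <;> ring
  simp only [hev, eval_mul, eval_C]
  have h := (hlow 0 hD).add ((tendsto_finsetSum (range D) fun l hl =>
    (hlow l (Finset.mem_range.1 hl)).const_mul (p.coeff l * (powerSumPoly l).eval x)).add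
    (htop.const_mul (p.coeff D * (powerSumPoly D).eval x)))
  simpa using h

/-- A polynomial with constant term `1` is determined by sufficiently many roots. -/
theorem eq_prod_one_sub_of_roots {K ι : Type*} [Field K] {p : K[X]} (h0 : p.coeff 0 = 1)
    {s : Finset ι} (hdeg : p.natDegree ≤ #s) {x : ι → K} (hinj : Set.InjOn x s)
    (hroot : ∀ i ∈ s, p.eval (x i) = 0) : p = ∏ i ∈ s, (1 - C (x i)⁻¹ * X) := by
  classical
  have hx0 : ∀ i ∈ s, x i ≠ 0 := by
    intro i hi h
    have := hroot i hi
    rw [h, ← coeff_zero_eq_eval_zero, h0] at this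
    exact one_ne_zero this
  have h0s : (0 : K) ∉ s.image x := by
    rw [Finset.mem_image]
    rintro ⟨i, hi, h⟩
    exact hx0 i hi h
  have hcard : #(insert 0 (s.image x)) = #s + 1 := by
    rw [Finset.card_insert_of_notMem h0s, Finset.card_image_of_injOn hinj]
  have hdeg' : (∏ i ∈ s, (1 - C (x i)⁻¹ * X)).natDegree ≤ #s := by
    refine (natDegree_prod_le _ _).trans ?_
    refine (Finset.sum_le_card_nsmul _ _ 1 fun i _ => ?_).trans (by simp)
    refine (natDegree_sub_le _ _).trans ?_
    rw [natDegree_one]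
    exact max_le (by omega) ((natDegree_C_mul_le _ _).trans natDegree_X_le)
  -- Both sides have degree at most `#s` and agree at `#s + 1` points: the roots, and `0`, where
  -- both equal `1`.
  refine eq_of_degree_sub_lt_of_eval_finset_eq (insert 0 (s.image x)) ?_ ?_
  · rw [hcard]
    refine (degree_le_of_natDegree_le ((natDegree_sub_le _ _).trans (max_le hdeg hdeg'))).trans_lt ?_
    exact_mod_cast Nat.lt_succ_self _
  · intro y hy
    rw [Finset.mem_insert, Finset.mem_image] at hy
    rcases hy with rfl | ⟨i, hi, rfl⟩
    · rw [← coeff_zero_eq_eval_zero, h0, eval_prod]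
      simp
    · rw [hroot i hi, eval_prod, Finset.prod_eq_zero hi]
      simp [hx0 i hi]

/-! ### Log-concavity and unimodality -/

/-- The coefficients of a product of factors `1 + b X`, `b ≥ 0`, are nonnegative and log-concave
without internal zeros. -/
theorem coeff_prod_one_add_log_concave {ι : Type*} (s : Finset ι) (b : ι → ℝ)
    (hb : ∀ i ∈ s, 0 ≤ b i) : (∀ i, 0 ≤ (∏ k ∈ s, (1 + C (b k) * X)).coeff i) ∧
      ∀ i j, i ≤ j → (∏ k ∈ s, (1 + C (b k) * X)).coeff i * (∏ k ∈ s, (1 + C (b k) * X)).coeff (j + 1)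
        ≤ (∏ k ∈ s, (1 + C (b k) * X)).coeff (i + 1) * (∏ k ∈ s, (1 + C (b k) * X)).coeff j := by
  classical
  induction s using Finset.induction_on with
  | empty =>
    simp only [Finset.prod_empty, coeff_one]
    refine ⟨fun i => by split_ifs <;> norm_num, fun i j _ => by simp⟩
  | insert k s hk ih =>
    obtain ⟨hpos, hlc⟩ := ih fun i hi => hb i (Finset.mem_insert_of_mem hi)
    rw [Finset.prod_insert hk]
    set q := ∏ k ∈ s, (1 + C (b k) * X)
    have hbk := hb k (Finset.mem_insert_self k s)
    have hz : ((1 + C (b k) * X) * q).coeff 0 = q.coeff 0 := by simp [mul_coeff_zero]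
    have hs : ∀ i, ((1 + C (b k) * X) * q).coeff (i + 1) = q.coeff (i + 1) + b k * q.coeff i := by
      intro i
      rw [add_mul, one_mul, coeff_add, mul_assoc, coeff_C_mul, coeff_X_mul]
    refine ⟨?_, ?_⟩
    · rintro (_ | i)
      · rw [hz]
        exact hpos 0
      · rw [hs]
        exact add_nonneg (hpos _) (mul_nonneg hbk (hpos _))
    · intro i j hij
      rcases hij.eq_or_lt with rfl | hij
      · rw [mul_comm]
      obtain ⟨j, rfl⟩ : ∃ j', j = j' + 1 := ⟨j - 1, by omega⟩
      rcases i with _ | i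
      · rw [hz, hs, hs, hs]
        have h1 := hlc 0 (j + 1) (by omega)
        have h2 := mul_nonneg hbk (mul_nonneg (hpos 1) (hpos j))
        have h3 := mul_nonneg (mul_self_nonneg (b k)) (mul_nonneg (hpos 0) (hpos j))
        simp only [zero_add] at h1 ⊢
        linarith
      · rw [hs, hs, hs, hs]
        have h1 := hlc (i + 1) (j + 1) (by omega)
        -- The terms linear in `b k` need `q_i q_{j+2} ≤ q_{i+2} q_j`, obtained through `q_{i+1}
        -- q_{j+1}`; the second link requires `i + 1 ≤ j`, hence the separate diagonal case.
        have h2 := mul_le_mul_of_nonneg_left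
          ((hlc i (j + 1) (by omega)).trans (hlc (i + 1) j (by omega))) hbk
        have h3 := mul_le_mul_of_nonneg_left (hlc i j (by omega)) (mul_self_nonneg (b k))
        linarith

theorem isLogConcave_of_mul_le {a : ℕ → ℕ} (h : ∀ i j, i ≤ j → a i * a (j + 1) ≤ a (i + 1) * a j)
    (d : ℕ) : IsLogConcave d a := by
  intro i hi _
  obtain ⟨i, rfl⟩ : ∃ i', i = i' + 1 := ⟨i - 1, by omega⟩
  rw [pow_two]
  exact h i (i + 1) (by omega)

theorem isUnimodal_of_mul_le {a : ℕ → ℕ} (h : ∀ i j, i ≤ j → a i * a (j + 1) ≤ a (i + 1) * a j)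
    (d : ℕ) : IsUnimodal d a := by
  classical
  -- The peak is the first strict descent. There `a m > 0`, so the inequality for `m ≤ j` can be
  -- cancelled to give `a (j + 1) ≤ a j`.
  have hex : ∃ m, m = d ∨ a (m + 1) < a m := ⟨d, Or.inl rfl⟩
  have hmin : ∀ i < Nat.find hex, a i ≤ a (i + 1) := fun i hi => by
    have := Nat.find_min hex hi
    push Not at this
    exact this.2
  refine ⟨Nat.find hex, Nat.find_min' hex (Or.inl rfl), ?_, ?_⟩
  · intro i j hij
    induction j, hij using Nat.le_induction with
    | base => exact fun _ => le_rfl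
    | succ j _ ih => exact fun hj => (ih (by omega)).trans (hmin j (by omega))
  · have hstep : ∀ j, Nat.find hex ≤ j → j < d → a (j + 1) ≤ a j := by
      intro j hj hjd
      rcases Nat.find_spec hex with hm | hm
      · omega
      · have h1 := (h _ j hj).trans (Nat.mul_le_mul_right (a j) hm.le)
        exact Nat.le_of_mul_le_mul_left h1 (by omega)
    intro i j hi hij
    induction j, hij using Nat.le_induction with
    | base => exact fun _ => le_rfl
    | succ j hj ih => exact fun hjd => (hstep j (by omega) (by omega)).trans (ih (by omega))

/-! ### Roots of the `f`-polynomials and conclusion -/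

theorem PreAbstractSimplicialComplex.HasDim.fVec_pos {W : Type*} [Finite W]
    {K : PreAbstractSimplicialComplex W} {D : ℕ} (hK : K.HasDim D) : 0 < K.fVec (D + 1) := by
  obtain ⟨s, hs, hcard⟩ := hK.1
  exact (Set.ncard_pos (Set.toFinite _)).2 ⟨s, hs, hcard⟩

theorem neg_of_eval_eq_zero_of_coeff_nonneg {p : ℝ[X]} (h0 : p.coeff 0 = 1)
    (hp : ∀ i, 0 ≤ p.coeff i) {x : ℝ} (hx : p.eval x = 0) : x < 0 := by
  by_contra! hx0
  rw [eval_eq_sum_range, Finset.sum_range_succ', h0] at hx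
  have : 0 ≤ ∑ i ∈ range p.natDegree, p.coeff (i + 1) * x ^ (i + 1) :=
    Finset.sum_nonneg fun i _ => mul_nonneg (hp _) (pow_nonneg hx0 _)
  simp only [pow_zero, mul_one] at hx
  linarith

/-- The roots of the `f`-polynomials of the edgewise subdivisions. -/
theorem exists_roots_veroneseFPoly {n D : ℕ} {K : PreAbstractSimplicialComplex (Fin n)}
    (hK : K.HasDim (D + 1)) {z : ℕ → ℝ} (hlt : ∀ i < D + 1, z i < z (i + 1))
    (hroot : ∀ i ≤ D + 1, (powerSumPoly (D + 1)).eval (z i) = 0) :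
    ∃ x : ℕ → ℕ → ℝ, (∀ i ≤ D + 1, Tendsto (x i) atTop (𝓝 (z i))) ∧
      ∀ᶠ r in atTop, (∀ i ≤ D + 1, x i r < 0) ∧
        veroneseFPoly (faceHilbertPoly K.fVec (D + 1)) (D + 1) r =
          ∏ i ∈ range (D + 2), (1 - C (x i r)⁻¹ * X) := by
  set p := faceHilbertPoly K.fVec (D + 1) with hp
  have hpD : p.coeff (D + 1) ≠ 0 := by
    rw [hp, coeff_faceHilbertPoly_self]
    have h1 := hK.fVec_pos
    have h2 := Nat.factorial_pos (D + 1)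
    positivity
  have hinj : Set.InjOn z (range (D + 2) : Finset ℕ) := by
    intro i hi j hj hij
    simp only [Finset.coe_range, Set.mem_Iio] at hi hj
    rcases lt_trichotomy i j with h | h | h
    · exact absurd hij (lt_of_lt_succ hlt h (by omega)).ne
    · exact h
    · exact absurd hij (lt_of_lt_succ hlt h (by omega)).ne'
  have hx : ∀ i, ∃ x : ℕ → ℝ, i ≤ D + 1 → Tendsto x atTop (𝓝 (z i)) ∧
      ∀ᶠ r in atTop, (veroneseFPoly p (D + 1) r).eval (x r) = 0 := by
    intro i
    by_cases hi : i ≤ D + 1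
    · have hd : (derivative (powerSumPoly (D + 1))).eval (z i) ≠ 0 := by
        refine eval_derivative_ne_zero_of_natDegree_le_card (powerSumPoly_ne_zero _)
          (s := (range (D + 2)).image z) ?_ ?_ ?_
        · rw [Finset.card_image_of_injOn hinj, Finset.card_range]
          exact natDegree_powerSumPoly_le _
        · intro y hy
          obtain ⟨j, hj, rfl⟩ := Finset.mem_image.1 hy
          exact hroot j (Nat.lt_succ_iff.1 (Finset.mem_range.1 hj))
        · exact Finset.mem_image_of_mem z (Finset.mem_range.2 (by omega))
      obtain ⟨x, hx⟩ := exists_tendsto_root (tendsto_eval_veroneseFPoly p (Nat.succ_pos D))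
        (z := z i) (by simp [hroot i hi]) (by simpa using ⟨hpD, hd⟩)
      exact ⟨x, fun _ => hx⟩
    · exact ⟨0, fun h => absurd h hi⟩
  choose x hx using hx
  refine ⟨x, fun i hi => (hx i hi).1, ?_⟩
  have hev : ∀ᶠ r in atTop, ∀ i ∈ range (D + 2), (veroneseFPoly p (D + 1) r).eval (x i r) = 0 :=
    (Finset.eventually_all _).2 fun i hi => (hx i (Nat.lt_succ_iff.1 (Finset.mem_range.1 hi))).2
  have hord : ∀ᶠ r in atTop, ∀ i ∈ range (D + 1), x i r < x (i + 1) r := by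
    refine (Finset.eventually_all _).2 fun i hi => ?_
    have hi := Finset.mem_range.1 hi
    exact (hx i (by omega)).1.eventually_lt (hx (i + 1) (by omega)).1 (hlt i hi)
  filter_upwards [hev, hord, eventually_gt_atTop 0] with r hr hlt' hr0
  refine ⟨fun i hi => ?_, ?_⟩
  · refine neg_of_eval_eq_zero_of_coeff_nonneg (coeff_zero_veroneseFPoly p (D + 1) r) (fun j => ?_)
      (hr i (Finset.mem_range.2 (by omega)))
    -- The edgewise subdivision realizes the coefficients as face numbers, so they are nonnegative
    -- and the roots negative.
    rw [coeff_veroneseFPoly_eq_fVec hK (edgewiseSubdivision K r) hr0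
      fun m hm => ncard_faceMonomials_edgewiseSubdivision K r hm]
    exact Nat.cast_nonneg _
  · refine eq_prod_one_sub_of_roots (coeff_zero_veroneseFPoly p (D + 1) r) ?_
      (x := fun i => x i r) ?_ hr
    · rw [Finset.card_range]
      exact natDegree_veroneseFPoly_le p (D + 1) r
    · intro i hi j hj hij
      have hlt'' : ∀ i < D + 1, x i r < x (i + 1) r := fun i hi => hlt' i (Finset.mem_range.2 hi)
      simp only [Finset.coe_range, Set.mem_Iio] at hi hj
      rcases lt_trichotomy i j with h | h | h
      · exact absurd hij (lt_of_lt_succ (z := fun i => x i r) hlt'' h (by omega)).ne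
      · exact h
      · exact absurd hij (lt_of_lt_succ (z := fun i => x i r) hlt'' h (by omega)).ne'

theorem fVec_log_concave_of_coeff_prod {ι V : Type*} [Finite V] (Γ : PreAbstractSimplicialComplex V)
    {s : Finset ι} {x : ι → ℝ} (hx : ∀ i ∈ s, x i < 0)
    (h : ∀ j, (∏ i ∈ s, (1 - C (x i)⁻¹ * X)).coeff j = (Γ.fVec j : ℝ)) (d : ℕ) :
    IsLogConcave d Γ.fVec ∧ IsUnimodal d Γ.fVec := by
  have h1 : ∏ i ∈ s, (1 - C (x i)⁻¹ * X) = ∏ i ∈ s, (1 + C (-(x i)⁻¹) * X) :=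
    Finset.prod_congr rfl fun i _ => by rw [C_neg, neg_mul, sub_eq_add_neg]
  have h2 := (coeff_prod_one_add_log_concave s (fun i => -(x i)⁻¹) fun i hi =>
    neg_nonneg.2 (inv_nonpos.2 (hx i hi).le)).2
  simp only [← h1, h] at h2
  have h3 : ∀ i j, i ≤ j → Γ.fVec i * Γ.fVec (j + 1) ≤ Γ.fVec (i + 1) * Γ.fVec j :=
    fun i j hij => by exact_mod_cast h2 i j hij
  exact ⟨isLogConcave_of_mul_le h3 d, isUnimodal_of_mul_le h3 d⟩

theorem fPoly_eq_map_prod_of_veroneseFPoly_eq {W V ι : Type*} [Finite W] [Finite V]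
    {K : PreAbstractSimplicialComplex W} {D : ℕ} (hK : K.HasDim D)
    (Γ : PreAbstractSimplicialComplex V) {r : ℕ} (hr : 0 < r)
    (h : ∀ m, 0 < m → (Γ.faceMonomials m).ncard = (K.faceMonomials (m * r)).ncard)
    {s : Finset ι} {x : ι → ℝ} (hx : ∀ i ∈ s, x i < 0)
    (hprod : veroneseFPoly (faceHilbertPoly K.fVec D) D r = ∏ i ∈ s, (1 - C (x i)⁻¹ * X)) (d : ℕ) :
    Γ.fPoly = (∏ i ∈ s, (1 - C (x i)⁻¹ * X) : ℝ[X]).map (algebraMap ℝ ℂ) ∧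
      IsLogConcave d Γ.fVec ∧ IsUnimodal d Γ.fVec := by
  have hc := coeff_veroneseFPoly_eq_fVec hK Γ hr h
  rw [hprod] at hc
  refine ⟨?_, fVec_log_concave_of_coeff_prod Γ hx hc d⟩
  ext i
  rw [coeff_fPoly, coeff_map, hc]
  simp

theorem mainTheorem8 (d : ℕ) (hd : 2 ≤ d) :
    ∃ α : ℕ → ℝ, ∀ (n : ℕ) (Δ : PreAbstractSimplicialComplex (Fin n)), Δ.HasDim (d - 1) →
      ∃ R : ℕ, 0 < R ∧ ∃ β : ℕ → ℕ → ℂ,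
        (∀ r > R, ∀ i ∈ Finset.Icc 1 d, (β r i).im = 0) ∧
        (∀ r > R, ∀ i ∈ Finset.Icc 1 (d - 1), (β r i).re < 0) ∧
        (∀ i ∈ Finset.Icc 1 (d - 2), Tendsto (fun r => β r i) atTop (𝓝 (α i : ℂ))) ∧
        Tendsto (fun r => (β r (d - 1)).re) atTop atBot ∧
        Tendsto (fun r => β r d) atTop (𝓝 (-1)) ∧
        -- for the edgewise subdivision of `Δ`
        (∀ r > R,
          (edgewiseSubdivision Δ r).fPoly = ∏ i ∈ Finset.Icc 1 d, (1 - C (β r i) * X) ∧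
          IsLogConcave d (edgewiseSubdivision Δ r).fVec ∧
          IsUnimodal d (edgewiseSubdivision Δ r).fVec) ∧
        -- and for every complex whose Stanley-Reisner ring has the Hilbert series of the Veronese
        (∀ r > R, ∀ (k : Type*) [Field k] (W : Type*) [Finite W]
          (Γ : PreAbstractSimplicialComplex W),
          hilbertSeries (stanleyReisnerGrading k Γ) =
            hilbertSeries (veroneseGrading (stanleyReisnerGrading k Δ) r) →
          Γ.fPoly = ∏ i ∈ Finset.Icc 1 d, (1 - C (β r i) * X) ∧
          IsLogConcave d Γ.fVec ∧
          IsUnimodal d Γ.fVec) := by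
  obtain ⟨D, rfl⟩ : ∃ D, d = D + 2 := ⟨d - 2, by omega⟩
  obtain ⟨z, hz0, hzD, hlt, hroot⟩ := exists_roots_powerSumPoly D
  refine ⟨fun i => (z i)⁻¹, fun n Δ hΔ => ?_⟩
  simp only [show D + 2 - 1 = D + 1 by omega, show D + 2 - 2 = D by omega] at hΔ ⊢
  obtain ⟨x, hx, hev⟩ := exists_roots_veroneseFPoly hΔ hlt hroot
  obtain ⟨R, hR⟩ := eventually_atTop.1 hev
  -- The roots are numbered from `0` in increasing order of their limits; root `0`, tending to `-1`,
  -- is moved to the last index `d = D + 2`.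
  set β : ℕ → ℕ → ℂ := fun r i => (((if i = D + 2 then x 0 r else x i r)⁻¹ : ℝ) : ℂ) with hβ
  have hβi : ∀ r, ∀ i ≤ D + 1, β r i = (((x i r)⁻¹ : ℝ) : ℂ) := fun r i hi => by
    simp [hβ, show i ≠ D + 2 by omega]
  have hprod : ∀ r, ∏ i ∈ Finset.Icc 1 (D + 2), (1 - C (β r i) * X) =
      (∏ i ∈ range (D + 2), (1 - C (x i r)⁻¹ * X) : ℝ[X]).map (algebraMap ℝ ℂ) := by
    intro r
    rw [Polynomial.map_prod, ← Finset.Ico_add_one_right_eq_Icc, Finset.prod_Ico_eq_prod_range,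
      show D + 2 + 1 - 1 = (D + 1) + 1 by omega, Finset.prod_range_succ,
      Finset.prod_range_succ' (fun i => Polynomial.map (algebraMap ℝ ℂ) (1 - C (x i r)⁻¹ * X))]
    refine congrArg₂ (· * ·) (Finset.prod_congr rfl fun i hi => ?_) ?_
    · have hi := Finset.mem_range.1 hi
      rw [add_comm 1 i, hβi r (i + 1) (by omega)]
      simp
    · rw [show 1 + (D + 1) = D + 2 by omega]
      simp [hβ]
  have hneg : ∀ r > R + 1, ∀ i ∈ range (D + 2), x i r < 0 := fun r hr i hi =>
    (hR r (by omega)).1 i (Nat.lt_succ_iff.1 (Finset.mem_range.1 hi))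
  refine ⟨R + 1, Nat.succ_pos R, β, ?_, ?_, ?_, ?_, ?_, ?_, ?_⟩
  · intro r _ i _
    exact Complex.ofReal_im _
  · intro r hr i hi
    have hi := (Finset.mem_Icc.1 hi).2
    rw [hβi r i hi, Complex.ofReal_re]
    exact inv_lt_zero.2 ((hR r (by omega)).1 i hi)
  · intro i hi
    have hi := Finset.mem_Icc.1 hi
    have hne : z i ≠ 0 := by
      rw [← hzD]
      exact (lt_of_lt_succ hlt (by omega) le_rfl).ne
    simp only [hβi _ i (show i ≤ D + 1 by omega)]
    exact (Complex.continuous_ofReal.tendsto _).comp ((hx i (by omega)).inv₀ hne)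
  · simp only [hβi _ (D + 1) le_rfl, Complex.ofReal_re]
    -- The root tends to `0` from the left, so its reciprocal tends to `-∞`.
    refine tendsto_inv_nhdsLT_zero.comp (tendsto_nhdsWithin_iff.2 ⟨hzD ▸ hx (D + 1) le_rfl, ?_⟩)
    filter_upwards [hev] with r hr
    exact hr.1 (D + 1) le_rfl
  · have h1 : ∀ r, β r (D + 2) = (((x 0 r)⁻¹ : ℝ) : ℂ) := fun r => by simp [hβ]
    simp only [h1]
    have h2 := (Complex.continuous_ofReal.tendsto _).comp
      ((hx 0 (by omega)).inv₀ (by rw [hz0]; norm_num))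
    rw [hz0] at h2
    simpa [Function.comp_def] using h2
  · intro r hr
    rw [hprod]
    exact fPoly_eq_map_prod_of_veroneseFPoly_eq hΔ _ (by omega)
      (fun m hm => ncard_faceMonomials_edgewiseSubdivision Δ r hm) (hneg r hr)
      (hR r (by omega)).2 _
  · intro r hr k _ W _ Γ hΓ
    rw [hprod]
    refine fPoly_eq_map_prod_of_veroneseFPoly_eq hΔ Γ (by omega) (fun m _ => ?_) (hneg r hr)
      (hR r (by omega)).2 _
    have h1 := congrArg (PowerSeries.coeff m) hΓ
    rw [hilbertSeries, hilbertSeries, PowerSeries.coeff_mk, PowerSeries.coeff_mk, veroneseGrading,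
      finrank_stanleyReisnerGrading, finrank_stanleyReisnerGrading] at h1
    exact h1
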